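/- Let $G$ be a locally compact (Hausdorff) group and $K\subseteq G$ a compact subgroup with normed Haar measure $\omega$. Let $\mathcal C(G)$ be the space of continuous functions $G\to\mathbb C$ with the topology of uniform convergence on compact sets, and let $\mathcal M_c(G)$ be its dual, i.e. the space of compactly supported complex (regular) Borel measures, with the weak*-topology, $\langle\mu,f\rangle=\int f\,d\mu$. For $f\in\mathcal C(G)$ put $f^{\#}(x)=\int_K\int_K f(kxl)\,d\omega(k)\,d\omega(l)$. Let $\mathcal C(G/\!/K)$ be the space of $f\in\mathcal C(G)$ with $f(kxl)=f(x)$ for all $x\in G$, $k,l\in K$, and let $\mathcal M_c(G/\!/K)$ be the space of $\mu\in\mathcal M_c(G)$ with $\langle\mu,f\rangle=\langle\mu,f^{\#}\rangle$ for all $f\in\mathcal C(G)$. It is an algebra under the convolution $\langle\mu*\nu,f\rangle=\iint f(xy)\,d\mu(x)\,d\nu(y)$, and it acts on $\mathcal C(G/\!/K)$ by $\mu*f(x)=\int f(y^{-1}x)\,d\mu(y)$. For $y\in G$ define $\delta_y^{\#}\in\mathcal M_c(G/\!/K)$ by $\langle\delta_y^{\#},f\rangle=f^{\#}(y)$; then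 $\delta_e^{\#}$ is the unit of $\mathcal M_c(G/\!/K)$. Assume that $(G,K)$ is a Gelfand pair, i.e. that $\mathcal M_c(G/\!/K)$ is commutative. A $K$-variety is a closed linear subspace $V$ of $\mathcal C(G/\!/K)$ such that $\delta_{y^{-1}}^{\#}*f\in V$ for all $f\in V$, $y\in G$. For $f\in\mathcal C(G/\!/K)$ let $\tau(f)$ be the intersection of all $K$-varieties containing $f$, and for a $K$-variety $V$ let $\mathrm{Ann}\,V=\{\mu\in\mathcal M_c(G/\!/K):\mu*f=0\text{ for all }f\in V\}$. A $K$-spherical function is a nonzero $s\in\mathcal C(G/\!/K)$ with $\int_K s(xky)\,d\omega(k)=s(x)s(y)$ for all $x,y\in G$. For such $s$ and $y\in G$ put $D_{s;y}=\delta_{y^{-1}}^{\#}-s(y)\,\delta_e^{\#}$, and let $M_s$ be the weak*-closure of the ideal of $\mathcal M_c(G/\!/K)$ generated by all $D_{s;y}$, $y\in G$. A function $\varphi\in\mathcal C(G/\!/K)$ is a generalized $K$-spherical monomial if there are a $K$-spherical function $s$ and a natural number $n\ge 0$ such that $$D_{s;y_1}*D_{s;y_2}*\dots*D_{s;y_{n+1}}*\varphi(x)=0\qquad\text{for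 all }x,y_1,\dots,y_{n+1}\in G. \tag{1}$$ A maximal ideal of $\mathcal M_c(G/\!/K)$ is called exponential if it is the kernel of a weak*-continuous algebra homomorphism of $\mathcal M_c(G/\!/K)$ onto $\mathbb C$. Lemma. Let $\varphi\in\mathcal C(G/\!/K)$ be nonzero. Then: (i) $\varphi$ is a generalized $K$-spherical monomial if and only if there exists a unique exponential maximal ideal $M$ of $\mathcal M_c(G/\!/K)$ such that $M^{n+1}\subseteq\mathrm{Ann}\,\tau(\varphi)$ for some natural number $n$. (ii) That $M$ is $M_s$ for the corresponding spherical function $s$: if $s$ is a $K$-spherical function and $n$ a natural number such that (1) holds, then $M_s$ is an exponential maximal ideal, $M_s^{n+1}\subseteq\mathrm{Ann}\,\tau(\varphi)\subseteq M_s$, and every exponential maximal ideal $M$ with $M^{m+1}\subseteq\mathrm{Ann}\,\tau(\varphi)$ for some natural number $m$ equals $M_s$. -/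

import Mathlib

open MeasureTheory Topology TopologicalSpace

noncomputable section

namespace KSpherical

section General

variable {X Y : Type*} [TopologicalSpace X] [TopologicalSpace Y]
  [LocallyCompactSpace X] [LocallyCompactSpace Y]

/-- Partial application of a functional: for `h ∈ C(X × Y)`, the continuous function
`x ↦ ⟨ν, h(x, ·)⟩` on `X`. -/
def partialApply (ν : C(Y, ℂ) →L[ℂ] ℂ) : C(X × Y, ℂ) →L[ℂ] C(X, ℂ) where
  toFun h := ⟨fun x => ν (h.curry x), ν.continuous.comp h.curry.continuous⟩
  map_add' h₁ h₂ := by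
    ext x
    exact map_add ν (h₁.curry x) (h₂.curry x)
  map_smul' c h := by
    ext x
    exact map_smul ν c (h.curry x)
  cont := (ContinuousMap.continuous_postcomp (⟨ν, ν.continuous⟩ : C(C(Y, ℂ), ℂ))).comp
    ContinuousMap.continuous_curry

/-- Composition with a fixed continuous map, as a continuous linear map. -/
def pullback (g : C(X, Y)) : C(Y, ℂ) →L[ℂ] C(X, ℂ) where
  toFun f := f.comp g
  map_add' _ _ := rfl
  map_smul' _ _ := rfl
  cont := ContinuousMap.continuous_precomp g

/-- A finite measure on a compact space, as a functional on continuous functions. -/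
def integralCLM [CompactSpace Y] [MeasurableSpace Y] [BorelSpace Y]
    (m : Measure Y) [IsFiniteMeasure m] : C(Y, ℂ) →L[ℂ] ℂ where
  toFun f := ∫ y, f y ∂m
  map_add' f g := integral_add (f.continuous.integrable_of_hasCompactSupport
    (HasCompactSupport.of_compactSpace f)) (g.continuous.integrable_of_hasCompactSupport
    (HasCompactSupport.of_compactSpace g))
  map_smul' c f := integral_const_mul c (fun y => f y)
  cont := by
    refine (LinearMap.mkContinuous (σ := RingHom.id ℂ) (E := C(Y, ℂ)) (F := ℂ)
      { toFun := fun f => ∫ y, f y ∂m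
        map_add' := fun f g => integral_add (f.continuous.integrable_of_hasCompactSupport
          (HasCompactSupport.of_compactSpace f)) (g.continuous.integrable_of_hasCompactSupport
          (HasCompactSupport.of_compactSpace g))
        map_smul' := fun c f => integral_const_mul c (fun y => f y) } (m.real Set.univ)
      fun f => ?_).continuous
    have := norm_integral_le_of_norm_le_const (μ := m) (f := fun y => f y) (C := ‖f‖)
      (Filter.Eventually.of_forall fun y => f.norm_coe_le_norm y)
    simpa [mul_comm] using this

lemma exists_compact_bound (ν : C(X, ℂ) →L[ℂ] ℂ) :
    ∃ L : Set X, IsCompact L ∧ ∃ δ > 0, ∀ f : C(X, ℂ), (∀ x ∈ L, ‖f x‖ < δ) → ‖ν f‖ < 1 := by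
  have h1 : ν ⁻¹' Metric.ball 0 1 ∈ 𝓝 (0 : C(X, ℂ)) :=
    ν.continuous.continuousAt.preimage_mem_nhds (by simpa using Metric.ball_mem_nhds (0:ℂ) one_pos)
  obtain ⟨⟨L, δ⟩, ⟨hL, hδ⟩, h⟩ :=
    ((Metric.nhds_basis_ball (x := (0 : ℂ))).nhds_continuousMapConst (X := X)).mem_iff.1 h1
  refine ⟨L, hL, δ, hδ, fun f hf => ?_⟩
  have := h (show f ∈ _ from fun x hx => by simpa using hf x hx)
  simpa using this

/-- A continuous functional on `C(X)` extends to the continuous functions on a compact set. -/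
lemma exists_extension (ν : C(X, ℂ) →L[ℂ] ℂ) :
    ∃ L : Set X, IsCompact L ∧ ∃ g : C(L, ℂ) →L[ℂ] ℂ, ∀ f : C(X, ℂ), ν f = g (f.restrict L) := by
  obtain ⟨L, hL, δ, hδ, hb⟩ := exists_compact_bound ν
  have : CompactSpace L := isCompact_iff_compactSpace.1 hL
  refine ⟨L, hL, ?_⟩
  let r : C(X, ℂ) →ₗ[ℂ] C(L, ℂ) :=
    { toFun := fun f => f.restrict L, map_add' := fun _ _ => rfl, map_smul' := fun _ _ => rfl }
  have hbound : ∀ f : C(X, ℂ), ‖ν f‖ ≤ (2 / δ) * ‖r f‖ := by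
    intro f
    refine le_of_forall_pos_le_add fun ε hε => ?_
    set t : ℝ := (2 / δ) * ‖r f‖ + ε with ht
    have htpos : 0 < t := by positivity
    have key : ‖ν (((t⁻¹ : ℝ) : ℂ) • f)‖ < 1 := by
      refine hb _ fun x hx => ?_
      have h1 : ‖f x‖ ≤ ‖r f‖ := (r f).norm_coe_le_norm ⟨x, hx⟩
      have h2 : ‖f x‖ < δ * t := by
        have : δ * t = 2 * ‖r f‖ + δ * ε := by rw [ht]; field_simp
        have : 0 < δ * ε := by positivity
        nlinarith [norm_nonneg (r f)]
      rw [ContinuousMap.smul_apply, norm_smul, Complex.norm_real, Real.norm_eq_abs,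
        abs_of_pos (inv_pos.2 htpos), inv_mul_lt_iff₀ htpos, mul_comm]
      exact h2
    rw [map_smul, norm_smul, Complex.norm_real, Real.norm_eq_abs,
        abs_of_pos (inv_pos.2 htpos), inv_mul_lt_iff₀ htpos, mul_one] at key
    exact key.le
  have hker : LinearMap.ker r ≤ LinearMap.ker (ν : C(X, ℂ) →ₗ[ℂ] ℂ) := by
    intro f hf
    have := hbound f
    rw [LinearMap.mem_ker.1 hf, norm_zero, mul_zero] at this
    exact norm_le_zero_iff.1 this
  let g₀ : LinearMap.range r →ₗ[ℂ] ℂ :=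
    ((LinearMap.ker r).liftQ (ν : C(X, ℂ) →ₗ[ℂ] ℂ) hker) ∘ₗ r.quotKerEquivRange.symm.toLinearMap
  have hg₀ : ∀ f, g₀ ⟨r f, f, rfl⟩ = ν f := by
    intro f
    have : r.quotKerEquivRange.symm ⟨r f, f, rfl⟩ = (LinearMap.ker r).mkQ f := by
      rw [LinearEquiv.symm_apply_eq]
      rfl
    show (LinearMap.ker r).liftQ (ν : C(X, ℂ) →ₗ[ℂ] ℂ) hker
      (r.quotKerEquivRange.symm ⟨r f, f, rfl⟩) = ν f
    rw [this]
    rfl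
  obtain ⟨g, hg, -⟩ := exists_extension_norm_eq (LinearMap.range r)
    (g₀.mkContinuous (2 / δ) (by
      rintro ⟨_, f, rfl⟩
      rw [hg₀]
      exact hbound f))
  exact ⟨g, fun f => ((hg ⟨r f, f, rfl⟩).trans (hg₀ f)).symm⟩

/-- A functional on `C(X)` commutes with integration over a compact space. -/
lemma functional_integral_comm [CompactSpace Y] [MeasurableSpace Y] [BorelSpace Y]
    (m : Measure Y) [IsFiniteMeasure m] (ν : C(X, ℂ) →L[ℂ] ℂ) (h : C(X × Y, ℂ)) :
    ν (partialApply (integralCLM m) h) =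
      ∫ y, ν (h.comp ⟨fun x => (x, y), by fun_prop⟩) ∂m := by
  obtain ⟨L, hL, g, hg⟩ := exists_extension ν
  have : CompactSpace L := isCompact_iff_compactSpace.1 hL
  let H : C(Y × L, ℂ) := h.comp ⟨fun p => (p.2.1, p.1), by fun_prop⟩
  have hi : Integrable (fun y => H.curry y) m :=
    H.curry.continuous.integrable_of_hasCompactSupport (HasCompactSupport.of_compactSpace _)
  simp_rw [hg]
  have e : (partialApply (integralCLM m) h).restrict L = ∫ y, H.curry y ∂m := by
    ext x
    rw [ContinuousMap.integral_apply hi]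
    rfl
  rw [e, ← g.integral_comp_comm hi]
  rfl

end General

section Group

variable {G : Type*} [Group G] [TopologicalSpace G] [IsTopologicalGroup G]
  [LocallyCompactSpace G]

/-- `M_c(G)`: the compactly supported complex (regular) Borel measures on `G`. By the Riesz
representation theorem these are exactly the continuous linear functionals on `C(G, ℂ)`, which
carries the topology of uniform convergence on compact sets, and this dual is used here,
with the weak-* topology. The value `μ f` is the integral of `f` with respect to `μ`. -/
abbrev CompactMeasure (G : Type*) [TopologicalSpace G] : Type _ := WeakDual ℂ C(G, ℂ)

/-- The convolution `μ * ν` of measures, `⟨μ * ν, f⟩ = ∫∫ f (x y) dν(y) dμ(x)`. -/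
def conv (μ ν : CompactMeasure G) : CompactMeasure G :=
  StrongDual.toWeakDual (μ.toStrongDual ∘L partialApply ν.toStrongDual ∘L
    pullback (⟨fun p : G × G => p.1 * p.2, by fun_prop⟩ : C(G × G, G)))

lemma continuous_inner (ν : CompactMeasure G) (f : C(G, ℂ)) :
    Continuous fun x : G => ν ⟨fun y => f (x * y), by fun_prop⟩ :=
  (partialApply ν.toStrongDual (f.comp ⟨fun p : G × G => p.1 * p.2, by fun_prop⟩)).continuous

lemma conv_apply (μ ν : CompactMeasure G) (f : C(G, ℂ)) :
    conv μ ν f = μ ⟨fun x => ν ⟨fun y => f (x * y), by fun_prop⟩,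
      continuous_inner ν f⟩ :=
  rfl

/-- The convolution `μ * f` of a measure and a function, `(μ * f)(x) = ∫ f (y⁻¹ x) dμ(y)`. -/
def convFun (μ : CompactMeasure G) : C(G, ℂ) →L[ℂ] C(G, ℂ) :=
  partialApply μ.toStrongDual ∘L
    pullback (⟨fun p : G × G => p.2⁻¹ * p.1, by fun_prop⟩ : C(G × G, G))

lemma convFun_apply (μ : CompactMeasure G) (f : C(G, ℂ)) (x : G) :
    convFun μ f x = μ ⟨fun y => f (y⁻¹ * x), by fun_prop⟩ :=
  rfl

lemma conv_assoc (μ ν ρ : CompactMeasure G) : conv (conv μ ν) ρ = conv μ (conv ν ρ) := by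
  refine DFunLike.ext _ _ fun f => ?_
  refine congrArg μ (ContinuousMap.ext fun x => congrArg ν (ContinuousMap.ext fun y =>
    congrArg ρ (ContinuousMap.ext fun z => ?_)))
  exact congrArg f (mul_assoc x y z)

lemma convFun_conv (μ ν : CompactMeasure G) (f : C(G, ℂ)) :
    convFun (conv μ ν) f = convFun μ (convFun ν f) := by
  ext x
  refine congrArg μ (ContinuousMap.ext fun y => congrArg ν (ContinuousMap.ext fun z => ?_))
  exact congrArg f (by simp [mul_assoc])

variable [MeasurableSpace G] [BorelSpace G] (K : Subgroup G) [CompactSpace K]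

/-- The normed Haar measure `ω` of the compact subgroup `K`. -/
def haarK : Measure K := Measure.haarMeasure ⊤

instance : (haarK K).IsHaarMeasure := by unfold haarK; infer_instance

instance : IsProbabilityMeasure (haarK K) :=
  ⟨by simpa [haarK] using Measure.haarMeasure_self (K₀ := (⊤ : PositiveCompacts K))⟩

lemma integral_mul_left_haarK (f : K → ℂ) (k : K) :
    ∫ l, f (k * l) ∂haarK K = ∫ l, f l ∂haarK K :=
  integral_mul_left_eq_self f k

lemma integral_mul_right_haarK (f : K → ℂ) (k : K) :
    ∫ l, f (l * k) ∂haarK K = ∫ l, f l ∂haarK K := by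
  have hm : Measure.map (· * k) (haarK K) = haarK K := by
    have : IsProbabilityMeasure (Measure.map (· * k) (haarK K)) :=
      Measure.isProbabilityMeasure_map (continuous_mul_const k).measurable.aemeasurable
    have : (Measure.map (· * k) (haarK K)).IsHaarMeasure :=
      Measure.isHaarMeasure_map_mul_right (haarK K) k
    exact Measure.isHaarMeasure_eq_of_isProbabilityMeasure _ _
  conv_rhs => rw [← hm]
  exact ((Homeomorph.mulRight k).measurableEmbedding.integral_map f).symm

/-- The projection `f ↦ f^#` of functions. -/
def proj : C(G, ℂ) →L[ℂ] C(G, ℂ) :=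
  partialApply (integralCLM (haarK K)) ∘L partialApply (integralCLM (haarK K)) ∘L
    pullback (⟨fun p : (G × K) × K => (p.1.2 : G) * p.1.1 * (p.2 : G), by fun_prop⟩ :
      C((G × K) × K, G))

lemma proj_apply (f : C(G, ℂ)) (x : G) :
    proj K f x = ∫ k : K, ∫ l : K, f ((k : G) * x * (l : G)) ∂haarK K ∂haarK K :=
  rfl

/-- `C(G//K)`: the continuous functions `f` with `f (k x l) = f x` for all `k, l ∈ K`. -/
def invFun : Submodule ℂ C(G, ℂ) where
  carrier := {f | ∀ x : G, ∀ k ∈ K, ∀ l ∈ K, f (k * x * l) = f x}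
  add_mem' {f g} hf hg x k hk l hl := by simp [hf x k hk l hl, hg x k hk l hl]
  zero_mem' _ _ _ _ _ := rfl
  smul_mem' c f hf x k hk l hl := by simp [hf x k hk l hl]

/-- `M_c(G//K)`: the measures `μ` with `⟨μ, f⟩ = ⟨μ, f^#⟩` for all `f`, with the
weak-* topology. -/
def InvMeasure : Submodule ℂ (CompactMeasure G) where
  carrier := {μ | ∀ f : C(G, ℂ), μ f = μ (proj K f)}
  add_mem' hμ hν f := congrArg₂ (· + ·) (hμ f) (hν f)
  zero_mem' _ := rfl
  smul_mem' c _ hμ f := congrArg (c • ·) (hμ f)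

/-- The function `x ↦ f (a x b)`. -/
def translate (a b : G) (f : C(G, ℂ)) : C(G, ℂ) :=
  f.comp ⟨fun x => a * x * b, by fun_prop⟩

lemma proj_translate (f : C(G, ℂ)) (a b : K) : proj K (translate (a : G) (b : G) f) = proj K f := by
  ext x
  rw [proj_apply, proj_apply]
  have h1 : ∀ k : K, ∫ l : K, translate (a : G) (b : G) f ((k : G) * x * (l : G)) ∂haarK K =
      ∫ l : K, f (((a * k : K) : G) * x * (l : G)) ∂haarK K := by
    intro k
    rw [← integral_mul_right_haarK K (fun l : K => f (((a * k : K) : G) * x * (l : G))) b]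
    simp [translate, mul_assoc]
  simp_rw [h1]
  exact integral_mul_left_haarK K
    (fun k : K => ∫ l : K, f ((k : G) * x * (l : G)) ∂haarK K) a

/-- `K`-invariance of a measure means invariance under two-sided translations by `K`. -/
lemma mem_InvMeasure_iff (μ : CompactMeasure G) :
    μ ∈ InvMeasure K ↔ ∀ (a b : K) (f : C(G, ℂ)), μ (translate (a : G) (b : G) f) = μ f := by
  constructor
  · intro h a b f
    rw [h f, ← proj_translate K f a b]
    exact h _
  · intro h f
    let F : C((G × K) × K, ℂ) :=
      f.comp ⟨fun p => (p.1.2 : G) * p.1.1 * (p.2 : G), by fun_prop⟩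
    have e1 : μ (proj K f) = ∫ k : K, μ.toStrongDual ((partialApply (integralCLM (haarK K)) F).comp
        ⟨fun x => (x, k), by fun_prop⟩) ∂haarK K :=
      functional_integral_comm (haarK K) μ.toStrongDual (partialApply (integralCLM (haarK K)) F)
    have e2 : ∀ k : K, μ.toStrongDual ((partialApply (integralCLM (haarK K)) F).comp
        ⟨fun x => (x, k), by fun_prop⟩) = μ f := by
      intro k
      have := functional_integral_comm (haarK K) μ.toStrongDual
        (F.comp (⟨fun p : G × K => ((p.1, k), p.2), by fun_prop⟩ : C(G × K, (G × K) × K)))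
      refine Eq.trans this ?_
      have e3 : ∀ l : K, μ.toStrongDual ((F.comp
          (⟨fun p : G × K => ((p.1, k), p.2), by fun_prop⟩ : C(G × K, (G × K) × K))).comp
          ⟨fun x => (x, l), by fun_prop⟩) = μ f := fun l => h k l f
      simp_rw [e3]
      simp
    rw [e1]
    simp_rw [e2]
    simp

lemma conv_mem {μ ν : CompactMeasure G} (hμ : μ ∈ InvMeasure K) (hν : ν ∈ InvMeasure K) :
    conv μ ν ∈ InvMeasure K := by
  rw [mem_InvMeasure_iff] at *
  intro a b f
  have h1 : conv μ ν (translate (a : G) (b : G) f) = conv μ ν (translate (a : G) 1 f) := by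
    rw [conv_apply, conv_apply]
    congr 1
    ext x
    refine Eq.trans ?_ (hν 1 b ⟨fun y => translate (a : G) 1 f (x * y), by fun_prop⟩)
    refine congrArg ν ?_
    ext y
    simp [translate, mul_assoc]
  rw [h1]
  refine Eq.trans ?_ (hμ a 1 ⟨fun x => ν ⟨fun y => f (x * y), by fun_prop⟩,
      continuous_inner ν f⟩)
  rw [conv_apply]
  congr 1
  ext x
  refine congrArg ν ?_
  ext y
  simp [translate, mul_assoc]

/-- The projection `δ_y^#` of the point mass at `y`: `⟨δ_y^#, f⟩ = f^#(y)`. -/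
def projDirac (y : G) : InvMeasure K :=
  ⟨StrongDual.toWeakDual (ContinuousMap.evalCLM ℂ y ∘L proj K), by
    rw [mem_InvMeasure_iff]
    intro a b f
    exact DFunLike.congr_fun (proj_translate K f a b) y⟩

lemma projDirac_apply (y : G) (f : C(G, ℂ)) :
    (projDirac K y : CompactMeasure G) f = proj K f y :=
  rfl

lemma projDirac_one_apply (f : C(G, ℂ)) :
    (projDirac K 1 : CompactMeasure G) f = ∫ k : K, f (k : G) ∂haarK K := by
  rw [projDirac_apply, proj_apply]
  have : ∀ k : K, ∫ l : K, f ((k : G) * 1 * (l : G)) ∂haarK K =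
      ∫ l : K, f (l : G) ∂haarK K := by
    intro k
    rw [← integral_mul_left_haarK K (fun l : K => f (l : G)) k]
    simp
  simp_rw [this]
  simp

instance : Mul (InvMeasure K) := ⟨fun μ ν => ⟨conv μ.1 ν.1, conv_mem K μ.2 ν.2⟩⟩

instance : One (InvMeasure K) := ⟨projDirac K 1⟩

lemma coe_mul' (μ ν : InvMeasure K) : ((μ * ν : InvMeasure K) : CompactMeasure G) = conv μ.1 ν.1 :=
  rfl

lemma one_mul' (μ : InvMeasure K) : 1 * μ = μ := by
  refine Subtype.ext (DFunLike.ext _ _ fun f => ?_)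
  refine (projDirac_one_apply K _).trans ?_
  have : ∀ k : K, μ.1 (⟨fun y => f ((k : G) * y), by fun_prop⟩ : C(G, ℂ)) = μ.1 f := by
    intro k
    refine Eq.trans (congrArg μ.1 ?_) ((mem_InvMeasure_iff K μ.1).1 μ.2 k 1 f)
    ext y
    simp [translate]
  refine (integral_congr_ae (Filter.Eventually.of_forall this)).trans ?_
  simp

lemma mul_one' (μ : InvMeasure K) : μ * 1 = μ := by
  refine Subtype.ext (DFunLike.ext _ _ fun f => ?_)
  have e : ∀ x : G, (projDirac K 1 : CompactMeasure G) ⟨fun y => f (x * y), by fun_prop⟩ =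
      ∫ k : K, f (x * (k : G)) ∂haarK K := fun x => projDirac_one_apply K _
  rw [coe_mul', conv_apply]
  have h := functional_integral_comm (haarK K) μ.1.toStrongDual
    (f.comp (⟨fun p : G × K => p.1 * (p.2 : G), by fun_prop⟩ : C(G × K, G)))
  refine Eq.trans (Eq.trans (congrArg μ.1 ?_) h) ?_
  · ext x
    exact e x
  · have h2 : ∀ k : K, μ.1.toStrongDual ((f.comp
        (⟨fun p : G × K => p.1 * (p.2 : G), by fun_prop⟩ : C(G × K, G))).comp
        ⟨fun x => (x, k), by fun_prop⟩) = μ.1 f := by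
      intro k
      refine Eq.trans (congrArg μ.1 ?_) ((mem_InvMeasure_iff K μ.1).1 μ.2 1 k f)
      ext y
      simp [translate]
    simp_rw [h2]
    simp

instance : AddCommGroup (InvMeasure K) := Module.addCommMonoidToAddCommGroup ℂ

/-- The convolution algebra `M_c(G//K)`; its unit is `δ_e^#`. -/
instance : Ring (InvMeasure K) :=
  { (inferInstance : AddCommGroup (InvMeasure K)),
    (inferInstance : Mul (InvMeasure K)),
    (inferInstance : One (InvMeasure K)) with
    mul_assoc := fun μ ν ρ => Subtype.ext (conv_assoc μ.1 ν.1 ρ.1)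
    one_mul := one_mul' K
    mul_one := mul_one' K
    left_distrib := fun μ ν ρ => Subtype.ext <| DFunLike.ext _ _ fun f =>
      map_add μ.1 (partialApply ν.1.toStrongDual (f.comp ⟨fun p : G × G => p.1 * p.2, by fun_prop⟩))
        (partialApply ρ.1.toStrongDual (f.comp ⟨fun p : G × G => p.1 * p.2, by fun_prop⟩))
    right_distrib := fun _ _ _ => rfl
    zero_mul := fun _ => rfl
    mul_zero := fun μ => Subtype.ext <| DFunLike.ext _ _ fun _ => map_zero μ.1 }

instance : Algebra ℂ (InvMeasure K) :=
  Algebra.ofModule (fun _ _ _ => rfl) (fun c μ ν => Subtype.ext <| DFunLike.ext _ _ fun f =>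
    map_smul μ.1 c (partialApply ν.1.toStrongDual
      (f.comp ⟨fun p : G × G => p.1 * p.2, by fun_prop⟩)))

/-- `(G, K)` is a Gelfand pair: the algebra `M_c(G//K)` is commutative. -/
class IsGelfandPair : Prop where
  mul_comm : ∀ μ ν : InvMeasure K, μ * ν = ν * μ

/-- The `K`-translation `τ_y f = δ_{y⁻¹}^# * f`. -/
def translation (y : G) (f : C(G, ℂ)) : C(G, ℂ) := convFun (projDirac K y⁻¹ : CompactMeasure G) f

/-- A `K`-variety: a closed linear subspace of `C(G//K)` (which is closed in `C(G)`) that is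
`K`-translation invariant. -/
structure IsVariety (V : Submodule ℂ C(G, ℂ)) : Prop where
  le_invFun : V ≤ invFun K
  isClosed : IsClosed (V : Set C(G, ℂ))
  translation_mem : ∀ f ∈ V, ∀ y : G, translation K y f ∈ V

/-- `τ(f)`: the intersection of all `K`-varieties containing the `K`-invariant function `f`. -/
def varietyOf (f : C(G, ℂ)) : Submodule ℂ C(G, ℂ) := sInf {V | IsVariety K V ∧ f ∈ V}

/-- `K`-spherical functions: the nonzero `K`-invariant continuous functions with
`∫_K f (x k y) dω(k) = f x f y`. -/
structure IsSpherical (s : C(G, ℂ)) : Prop where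
  mem_invFun : s ∈ invFun K
  ne_zero : s ≠ 0
  map_mul : ∀ x y : G, ∫ k : K, s (x * (k : G) * y) ∂haarK K = s x * s y

section Gelfand

variable [IsGelfandPair K]

instance : CommRing (InvMeasure K) :=
  { (inferInstance : Ring (InvMeasure K)) with mul_comm := IsGelfandPair.mul_comm }

instance : ContinuousAdd (InvMeasure K) where
  continuous_add := Continuous.subtype_mk
    ((continuous_subtype_val.comp continuous_fst).add
      (continuous_subtype_val.comp continuous_snd)) _

/-- Convolution is separately weak-* continuous. -/
instance : ContinuousConstSMul (InvMeasure K) (InvMeasure K) where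
  continuous_const_smul ν := by
    simp_rw [smul_eq_mul, mul_comm ν]
    refine Continuous.subtype_mk (WeakDual.continuous_of_continuous_eval fun f => ?_) _
    exact (WeakDual.eval_continuous
      (partialApply ν.1.toStrongDual (f.comp ⟨fun p : G × G => p.1 * p.2, by fun_prop⟩))).comp
      continuous_subtype_val

/-- The annihilator of a subspace `V` of `C(G//K)` in `M_c(G//K)`. -/
def ann (V : Submodule ℂ C(G, ℂ)) : Ideal (InvMeasure K) where
  carrier := {μ | ∀ f ∈ V, convFun (μ : CompactMeasure G) f = 0}
  add_mem' {μ ν} hμ hν f hf := by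
    have : convFun ((μ + ν : InvMeasure K) : CompactMeasure G) f =
      convFun (μ : CompactMeasure G) f + convFun (ν : CompactMeasure G) f := rfl
    rw [this, hμ f hf, hν f hf, add_zero]
  zero_mem' _ _ := rfl
  smul_mem' ν μ hμ f hf := by
    rw [smul_eq_mul, coe_mul', convFun_conv, hμ f hf, map_zero]

/-- The modified `K`-spherical difference `D_{f;y} = δ_{y⁻¹}^# - f(y) δ_e`; here `δ_e` is the unit
of `M_c(G//K)`. -/
def sphDiff (f : C(G, ℂ)) (y : G) : InvMeasure K := projDirac K y⁻¹ - f y • (1 : InvMeasure K)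

/-- `M_f`: the (weak-*) closure of the ideal generated by all `D_{f;y}`, `y ∈ G`. -/
def sphIdeal (f : C(G, ℂ)) : Ideal (InvMeasure K) :=
  Submodule.topologicalClosure (Ideal.span (Set.range (sphDiff K f)))

/-- Exponential maximal ideals: the maximal ideals of `M_c(G//K)` which are the kernel of a
continuous algebra homomorphism of `M_c(G//K)` onto `ℂ`. -/
def IsExponentialMaximal (M : Ideal (InvMeasure K)) : Prop :=
  M.IsMaximal ∧ ∃ Φ : InvMeasure K →ₐ[ℂ] ℂ,
    Continuous Φ ∧ Function.Surjective Φ ∧ RingHom.ker Φ = M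

/-- The equation `D_{s;y₁} * ⋯ * D_{s;yₙ₊₁} * φ = 0` for all `y₁, …, yₙ₊₁ ∈ G`. -/
def SphDiffEq (s : C(G, ℂ)) (n : ℕ) (φ : C(G, ℂ)) : Prop :=
  ∀ (y : Fin (n + 1) → G) (x : G),
    convFun ((∏ i, sphDiff K s (y i) : InvMeasure K) : CompactMeasure G) φ x = 0

/-- Generalized `K`-spherical monomials. -/
def IsGenMonomial (φ : C(G, ℂ)) : Prop :=
  φ ∈ invFun K ∧ ∃ s : C(G, ℂ), IsSpherical K s ∧ ∃ n : ℕ, SphDiffEq K s n φ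

end Gelfand

end Group

end KSpherical

end

/-!
The pairing `(μ, f) ↦ (μ * f)(e)` identifies `C(G//K)` with the weak-* continuous linear
functionals on `M_c(G//K)`, and the characters among these correspond to the spherical functions:
a spherical `s` is a common eigenfunction, `μ * s = Φ_s(μ) s`, whose eigenvalue
`Φ_s(μ) = (μ * s)(e)` is multiplicative in `μ`. Pairing `f` with `D_{s;y}` gives
`f(y) - s(y) f(e)`, so an `f` that annihilates `M_s` is the multiple `f(e) s` of `s`; by the
Hahn–Banach theorem `M_s = ker Φ_s`, and the exponential maximal ideals are exactly the `M_s`.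
Since `Ann τ(φ)` is weak-* closed, equation (1) says that `M_s ^ (n + 1) ≤ Ann τ(φ)`, and
`Ann τ(φ)` is proper as `φ ≠ 0`. A proper ideal contains powers of at most one maximal ideal.
-/

namespace KSpherical

section Ideals

variable {R : Type*} [CommRing R]

lemma le_of_pow_le_of_isMaximal {M J : Ideal R} (hM : M.IsMaximal) (hJ : J ≠ ⊤) {n : ℕ}
    (h : M ^ n ≤ J) : J ≤ M := by
  obtain ⟨P, hP, hJP⟩ := Ideal.exists_le_maximal J hJ
  have := hP.isPrime
  rwa [hM.eq_of_le hP.ne_top (Ideal.IsPrime.le_of_pow_le (h.trans hJP))]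

lemma eq_of_pow_le_of_isMaximal {M N J : Ideal R} (hM : M.IsMaximal) (hN : N.IsMaximal)
    (hJ : J ≠ ⊤) {m n : ℕ} (hm : M ^ m ≤ J) (hn : N ^ n ≤ J) : M = N := by
  have := hN.isPrime
  exact hM.eq_of_le hN.ne_top
    (Ideal.IsPrime.le_of_pow_le (hm.trans (le_of_pow_le_of_isMaximal hN hJ hn)))

variable [TopologicalSpace R] [ContinuousAdd R] [ContinuousConstSMul R R]

lemma topologicalClosure_mul_le (I J : Ideal R) :
    Submodule.topologicalClosure I * Submodule.topologicalClosure J ≤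
      Submodule.topologicalClosure (I * J) := by
  have continuous_mul_left (a : R) : Continuous (a * ·) := continuous_const_smul a
  have continuous_mul_right (b : R) : Continuous (· * b) := by
    simpa only [mul_comm] using continuous_mul_left b
  exact Ideal.mul_le.2 fun a ha b hb => map_mem_closure₂' (f := fun a b : R => a * b)
    continuous_mul_left continuous_mul_right ha hb fun a ha b hb => Ideal.mul_mem_mul ha hb

lemma topologicalClosure_pow_le (I : Ideal R) (n : ℕ) :
    Submodule.topologicalClosure I ^ n ≤ Submodule.topologicalClosure (I ^ n) := by
  induction n with
  | zero => simpa only [pow_zero] using Submodule.le_topologicalClosure _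
  | succ n ih =>
    simp only [pow_succ]
    exact (Ideal.mul_mono_left ih).trans (topologicalClosure_mul_le _ _)

end Ideals

section Duality

variable {𝕜 E : Type*} [NontriviallyNormedField 𝕜] [AddCommGroup E] [Module 𝕜 E]
  [TopologicalSpace E]

lemma exists_strongDual_eq_zero_on_apply_ne_zero [IsRCLikeNormedField 𝕜] [PolynormableSpace 𝕜 E]
    {W : Submodule 𝕜 E} (hW : IsClosed (W : Set E)) {x : E} (hx : x ∉ W) :
    ∃ Φ : StrongDual 𝕜 E, (∀ y ∈ W, Φ y = 0) ∧ Φ x ≠ 0 := by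
  have := (PolynormableSpace.withSeminorms 𝕜 E).topologicalAddGroup
  have := (PolynormableSpace.withSeminorms 𝕜 E).continuousSMul
  obtain ⟨l, hlx, hWl⟩ := Submodule.exists_le_ker_of_notMem hx
  let S := W ⊔ 𝕜 ∙ x
  have hxS : x ∈ S := Submodule.mem_sup_right (Submodule.mem_span_singleton_self x)
  have hker : LinearMap.ker (l.domRestrict S) = W.comap S.subtype := by
    refine le_antisymm ?_ fun z hz => hWl hz
    rintro ⟨z, hz⟩ hlz
    obtain ⟨y, hy, w, hw, rfl⟩ := Submodule.mem_sup.1 hz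
    obtain ⟨c, rfl⟩ := Submodule.mem_span_singleton.1 hw
    have hc : c * l x = 0 := by
      calc c * l x = l (y + c • x) := by
            rw [map_add, LinearMap.mem_ker.1 (hWl hy), zero_add, map_smul, smul_eq_mul]
        _ = 0 := hlz
    have hc0 : c = 0 := (mul_eq_zero.1 hc).resolve_right hlx
    change y + c • x ∈ W
    rwa [hc0, zero_smul, add_zero]
  have hcont : Continuous (l.domRestrict S) :=
    LinearMap.continuous_of_isClosed_ker _ (hker ▸ hW.preimage continuous_subtype_val)
  obtain ⟨Φ, hΦ⟩ := StrongDual.exists_extension S ⟨l.domRestrict S, hcont⟩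
  exact ⟨Φ, fun y hy => (hΦ ⟨y, Submodule.mem_sup_left hy⟩).trans (hWl hy),
    fun h => hlx ((hΦ ⟨x, hxS⟩).symm.trans h)⟩

instance : PolynormableSpace 𝕜 (WeakDual 𝕜 E) :=
  (topDualPairing 𝕜 E).weakBilin_withSeminorms.toPolynormableSpace

variable [IsRCLikeNormedField 𝕜]

lemma exists_eq_apply_of_strongDual_weakDual {S : Submodule 𝕜 (WeakDual 𝕜 E)}
    (Φ : StrongDual 𝕜 S) : ∃ f : E, ∀ μ : S, Φ μ = μ.1 f := by
  obtain ⟨Ψ, hΨ⟩ := StrongDual.exists_extension S Φ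
  obtain ⟨f, hf⟩ := (topDualPairing 𝕜 E).dualEmbedding_surjective Ψ
  exact ⟨f, fun μ => (hΨ μ).symm.trans (DFunLike.congr_fun hf μ.1).symm⟩

lemma exists_eq_zero_on_apply_ne_zero_of_notMem_weakDual {W : Submodule 𝕜 (WeakDual 𝕜 E)}
    (hW : IsClosed (W : Set (WeakDual 𝕜 E))) {μ : WeakDual 𝕜 E} (hμ : μ ∉ W) :
    ∃ f : E, (∀ ν ∈ W, ν f = 0) ∧ μ f ≠ 0 := by
  obtain ⟨Φ, hΦW, hΦμ⟩ := exists_strongDual_eq_zero_on_apply_ne_zero hW hμ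
  obtain ⟨f, rfl⟩ := (topDualPairing 𝕜 E).dualEmbedding_surjective Φ
  exact ⟨f, hΦW, hΦμ⟩

end Duality

lemma isInvInvariant_of_compactSpace {H : Type*} [Group H] [TopologicalSpace H]
    [IsTopologicalGroup H] [CompactSpace H] [MeasurableSpace H] [BorelSpace H] (m : Measure H)
    [m.IsHaarMeasure] [IsProbabilityMeasure m] : m.IsInvInvariant := by
  have : m.IsMulRightInvariant := ⟨fun h => by
    have := Measure.isProbabilityMeasure_map (μ := m) (measurable_mul_const h).aemeasurable
    have := Measure.isHaarMeasure_map_mul_right m h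
    exact Measure.isHaarMeasure_eq_of_isProbabilityMeasure _ m⟩
  have : m.inv.IsHaarMeasure := {
    toIsMulLeftInvariant := inferInstance
    toIsOpenPosMeasure := continuous_inv.isOpenPosMeasure_map inv_surjective
    lt_top_of_isCompact := fun _ _ => measure_lt_top _ _ }
  have : IsProbabilityMeasure m.inv :=
    Measure.isProbabilityMeasure_map measurable_inv.aemeasurable
  exact ⟨Measure.isHaarMeasure_eq_of_isProbabilityMeasure _ m⟩

section InvariantFunctions

variable {G : Type*} [Group G] [TopologicalSpace G]

lemma isClosed_invFun (K : Subgroup G) : IsClosed (invFun K : Set C(G, ℂ)) := by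
  have : (invFun K : Set C(G, ℂ)) =
      ⋂ (x : G) (k ∈ K) (l ∈ K), {f : C(G, ℂ) | f (k * x * l) = f x} := by
    ext f
    simp only [Set.mem_iInter]
    rfl
  rw [this]
  exact isClosed_iInter fun x => isClosed_biInter fun k _ => isClosed_biInter fun l _ =>
    isClosed_eq (continuous_eval_const _) (continuous_eval_const _)

variable {K : Subgroup G} {f : C(G, ℂ)}

lemma invFun_mul_left (hf : f ∈ invFun K) (k : K) (x : G) : f (k * x) = f x := by
  simpa only [mul_one] using hf x k k.2 1 K.one_mem

lemma invFun_mul_right (hf : f ∈ invFun K) (x : G) (k : K) : f (x * k) = f x := by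
  simpa only [one_mul] using hf x 1 K.one_mem k k.2

variable [IsTopologicalGroup G]

lemma comp_inv_mem_invFun (hf : f ∈ invFun K) :
    f.comp ⟨fun x => x⁻¹, continuous_inv⟩ ∈ invFun K := fun x k hk l hl => by
  simpa [mul_assoc] using hf x⁻¹ l⁻¹ (K.inv_mem hl) k⁻¹ (K.inv_mem hk)

variable [MeasurableSpace G] [BorelSpace G] [CompactSpace K]

lemma integral_inv_haarK (f : K → ℂ) : ∫ k, f k⁻¹ ∂haarK K = ∫ k, f k ∂haarK K :=
  have := isInvInvariant_of_compactSpace (haarK K)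
  integral_inv_eq_self f (haarK K)

lemma IsSpherical.apply_one {s : C(G, ℂ)} (hs : IsSpherical K s) : s 1 = 1 := by
  obtain ⟨x, hx⟩ := DFunLike.ne_iff.1 hs.ne_zero
  have h := hs.map_mul x 1
  simp only [mul_one, invFun_mul_right hs.mem_invFun, integral_const, probReal_univ,
    one_smul] at h
  exact (mul_eq_left₀ hx).1 h.symm

variable (K) in
lemma proj_mem_invFun [LocallyCompactSpace G] (f : C(G, ℂ)) : proj K f ∈ invFun K := by
  intro x k hk l hl
  lift k to K using hk
  lift l to K using hl
  calc proj K f (k * x * l)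
      = ∫ a : K, ∫ b : K, f ((a * k : K) * x * (l * b : K)) ∂haarK K ∂haarK K := by
        simp only [proj_apply, Subgroup.coe_mul, mul_assoc]
    _ = ∫ a : K, ∫ b : K, f ((a * k : K) * x * b) ∂haarK K ∂haarK K :=
        integral_congr_ae <| .of_forall fun a =>
          integral_mul_left_haarK K (fun b : K => f ((a * k : K) * x * b)) l
    _ = proj K f x :=
        integral_mul_right_haarK K (fun a : K => ∫ b : K, f (a * x * b) ∂haarK K) k

end InvariantFunctions

section Pairing

variable {G : Type*} [Group G] [TopologicalSpace G] [IsTopologicalGroup G]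
  [LocallyCompactSpace G] [MeasurableSpace G] [BorelSpace G]
  {K : Subgroup G} [CompactSpace K] {f : C(G, ℂ)}

lemma convFun_mul (μ ν : InvMeasure K) (f : C(G, ℂ)) :
    convFun (μ * ν).1 f = convFun μ.1 (convFun ν.1 f) :=
  convFun_conv _ _ _

lemma continuous_convFun_apply (f : C(G, ℂ)) (x : G) :
    Continuous fun μ : InvMeasure K => convFun μ.1 f x :=
  (WeakDual.eval_continuous (⟨fun y => f (y⁻¹ * x), by fun_prop⟩ : C(G, ℂ))).comp
    continuous_subtype_val

lemma convFun_mem_invFun (μ : InvMeasure K) (hf : f ∈ invFun K) :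
    convFun μ.1 f ∈ invFun K := by
  intro x k hk l hl
  rw [convFun_apply, convFun_apply,
    ← (mem_InvMeasure_iff K μ.1).1 μ.2 (⟨k, hk⟩⁻¹ : K) 1 ⟨fun y => f (y⁻¹ * x), by fun_prop⟩]
  congr 1
  ext y
  simpa [translate, mul_assoc] using hf (y⁻¹ * (k * x)) 1 K.one_mem l hl

lemma convFun_projDirac_apply (hf : f ∈ invFun K) (y x : G) :
    convFun (projDirac K y).1 f x = ∫ k : K, f (y⁻¹ * k * x) ∂haarK K := by
  have integrand (k l : K) : f ((k * y * l)⁻¹ * x) = f (y⁻¹ * (k⁻¹ : K) * x) := by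
    rw [← invFun_mul_left hf l⁻¹ (y⁻¹ * (k⁻¹ : K) * x)]
    simp [mul_assoc]
  rw [convFun_apply, projDirac_apply, proj_apply]
  simp only [ContinuousMap.coe_mk, integrand, integral_const, probReal_univ, one_smul]
  exact integral_inv_haarK fun k : K => f (y⁻¹ * k * x)

lemma convFun_one (hf : f ∈ invFun K) : convFun (1 : InvMeasure K).1 f = f := by
  ext x
  refine (convFun_projDirac_apply hf 1 x).trans ?_
  simp only [inv_one, one_mul, invFun_mul_left hf, integral_const, probReal_univ, one_smul]

variable (K) in
/-- The pairing `(f, μ) ↦ (μ * f)(e) = ∫ f(y⁻¹) dμ(y)` of functions and `K`-invariant measures.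
It is preferred to `μ f` because convolution acts on it: `pairing_mul`. -/
noncomputable def pairing : C(G, ℂ) →ₗ[ℂ] InvMeasure K →ₗ[ℂ] ℂ :=
  LinearMap.mk₂ ℂ (fun f μ => convFun μ.1 f 1)
    (fun f g μ => by rw [map_add, ContinuousMap.add_apply])
    (fun c f μ => by rw [map_smul, ContinuousMap.smul_apply])
    (fun _ _ _ => rfl) (fun _ _ _ => rfl)

lemma pairing_apply (f : C(G, ℂ)) (μ : InvMeasure K) : pairing K f μ = convFun μ.1 f 1 := rfl

lemma continuous_pairing (f : C(G, ℂ)) : Continuous (pairing K f) :=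
  continuous_convFun_apply f 1

lemma pairing_mul (f : C(G, ℂ)) (μ ν : InvMeasure K) :
    pairing K f (μ * ν) = pairing K (convFun ν.1 f) μ :=
  DFunLike.congr_fun (convFun_mul μ ν f) 1

lemma pairing_one (hf : f ∈ invFun K) : pairing K f 1 = f 1 :=
  DFunLike.congr_fun (convFun_one hf) 1

lemma pairing_projDirac (hf : f ∈ invFun K) (y : G) : pairing K f (projDirac K y) = f y⁻¹ := by
  rw [pairing_apply, convFun_projDirac_apply hf]
  simp only [mul_one, invFun_mul_right hf, integral_const, probReal_univ, one_smul]

lemma pairing_sphDiff (hf : f ∈ invFun K) (s : C(G, ℂ)) (y : G) :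
    pairing K f (sphDiff K s y) = f y - s y * f 1 := by
  rw [sphDiff, map_sub, map_smul, pairing_projDirac hf, pairing_one hf, inv_inv, smul_eq_mul]

lemma exists_mem_invFun_pairing_eq_apply (g : C(G, ℂ)) :
    ∃ f ∈ invFun K, ∀ μ : InvMeasure K, pairing K f μ = μ.1 g := by
  refine ⟨_, comp_inv_mem_invFun (proj_mem_invFun K g), fun μ => ?_⟩
  rw [μ.2 g, pairing_apply, convFun_apply]
  congr 1
  ext y
  simp

lemma exists_mem_invFun_pairing_eq (Φ : InvMeasure K →ₗ[ℂ] ℂ) (hΦ : Continuous Φ) :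
    ∃ f ∈ invFun K, pairing K f = Φ := by
  let Φ' : StrongDual ℂ (InvMeasure K) := ⟨Φ, hΦ⟩
  obtain ⟨g, hg⟩ := exists_eq_apply_of_strongDual_weakDual (E := C(G, ℂ)) Φ'
  obtain ⟨f, hf, hfg⟩ := exists_mem_invFun_pairing_eq_apply (K := K) g
  exact ⟨f, hf, LinearMap.ext fun μ => (hfg μ).trans (hg μ).symm⟩

lemma mem_of_forall_pairing_eq_zero {W : Submodule ℂ (InvMeasure K)}
    (hW : IsClosed (W : Set (InvMeasure K))) {μ : InvMeasure K}
    (h : ∀ f ∈ invFun K, (∀ ν ∈ W, pairing K f ν = 0) → pairing K f μ = 0) : μ ∈ W := by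
  let W' : Submodule ℂ (CompactMeasure G) := W.map (InvMeasure K).subtype
  suffices hμ : μ.1 ∈ W'.topologicalClosure from hW.closure_subset (closure_subtype.2 hμ)
  by_contra hμ
  obtain ⟨g, hgW, hgμ⟩ := exists_eq_zero_on_apply_ne_zero_of_notMem_weakDual (E := C(G, ℂ))
    W'.isClosed_topologicalClosure hμ
  obtain ⟨f, hf, hfg⟩ := exists_mem_invFun_pairing_eq_apply (K := K) g
  refine hgμ ((hfg μ).symm.trans (h f hf fun ν hν => (hfg ν).trans (hgW _ ?_)))
  exact Submodule.le_topologicalClosure _ ⟨ν, hν, rfl⟩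

lemma IsSpherical.convFun_projDirac {s : C(G, ℂ)} (hs : IsSpherical K s) (y : G) :
    convFun (projDirac K y).1 s = s y⁻¹ • s := by
  ext x
  rw [convFun_projDirac_apply hs.mem_invFun, hs.map_mul, ContinuousMap.smul_apply, smul_eq_mul]

end Pairing

section Gelfand

variable {G : Type*} [Group G] [TopologicalSpace G] [IsTopologicalGroup G]
  [LocallyCompactSpace G] [MeasurableSpace G] [BorelSpace G]
  {K : Subgroup G} [CompactSpace K] [IsGelfandPair K] {f s : C(G, ℂ)}

lemma IsSpherical.convFun_eq (hs : IsSpherical K s) (μ : InvMeasure K) :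
    convFun μ.1 s = pairing K s μ • s := by
  ext x
  calc convFun μ.1 s x
      = pairing K (convFun μ.1 s) (projDirac K x⁻¹) := by
        rw [pairing_projDirac (convFun_mem_invFun μ hs.mem_invFun), inv_inv]
    _ = pairing K (convFun (projDirac K x⁻¹).1 s) μ := by
        rw [← pairing_mul, mul_comm, pairing_mul]
    _ = (pairing K s μ • s) x := by
        rw [hs.convFun_projDirac, inv_inv, map_smul, LinearMap.smul_apply,
          ContinuousMap.smul_apply, smul_eq_mul, smul_eq_mul, mul_comm]

/-- The character of `M_c(G//K)` attached to a spherical function `s`: the eigenvalue of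
convolution by `μ` at the eigenfunction `s`. -/
noncomputable def IsSpherical.character (hs : IsSpherical K s) : InvMeasure K →ₐ[ℂ] ℂ :=
  AlgHom.ofLinearMap (pairing K s) ((pairing_one hs.mem_invFun).trans hs.apply_one) fun μ ν => by
    rw [pairing_mul, hs.convFun_eq, map_smul, LinearMap.smul_apply, smul_eq_mul, mul_comm]

lemma IsSpherical.character_apply (hs : IsSpherical K s) (μ : InvMeasure K) :
    hs.character μ = pairing K s μ := rfl

lemma IsSpherical.sphIdeal_eq_ker (hs : IsSpherical K s) :
    sphIdeal K s = RingHom.ker hs.character := by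
  apply le_antisymm
  · refine Submodule.topologicalClosure_minimal _ (Ideal.span_le.2 ?_)
      (isClosed_singleton.preimage (continuous_pairing s))
    rintro _ ⟨y, rfl⟩
    change pairing K s (sphDiff K s y) = 0
    rw [pairing_sphDiff hs.mem_invFun, hs.apply_one, mul_one, sub_self]
  · intro μ hμ
    refine mem_of_forall_pairing_eq_zero (W := (sphIdeal K s).restrictScalars ℂ)
      (Submodule.isClosed_topologicalClosure _) fun f hf hfs => ?_
    have hf_eq : f = f 1 • s := by
      ext y
      have hy : sphDiff K s y ∈ sphIdeal K s :=
        Submodule.le_topologicalClosure _ (Ideal.subset_span ⟨y, rfl⟩)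
      have := hfs _ hy
      rw [pairing_sphDiff hf, sub_eq_zero] at this
      rw [this, ContinuousMap.smul_apply, smul_eq_mul, mul_comm]
    rw [hf_eq, map_smul, LinearMap.smul_apply, ← hs.character_apply, RingHom.mem_ker.1 hμ,
      smul_zero]

lemma exists_isSpherical_character_eq (Φ : InvMeasure K →ₐ[ℂ] ℂ) (hΦ : Continuous Φ) :
    ∃ (s : C(G, ℂ)) (hs : IsSpherical K s), hs.character = Φ := by
  obtain ⟨s, hs_inv, hsΦ⟩ := exists_mem_invFun_pairing_eq Φ.toLinearMap hΦ
  have pairing_eq (μ : InvMeasure K) : pairing K s μ = Φ μ := DFunLike.congr_fun hsΦ μ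
  have apply_eq (y : G) : s y = Φ (projDirac K y⁻¹) := by
    rw [← pairing_eq, pairing_projDirac hs_inv, inv_inv]
  have apply_one : s 1 = 1 := by rw [← pairing_one hs_inv, pairing_eq, map_one]
  have hs : IsSpherical K s := by
    refine ⟨hs_inv, fun h => by simp [h] at apply_one, fun x y => ?_⟩
    calc ∫ k : K, s (x * k * y) ∂haarK K
        = convFun (projDirac K x⁻¹).1 s y := by
          rw [convFun_projDirac_apply hs_inv, inv_inv]
      _ = pairing K s (projDirac K y⁻¹ * projDirac K x⁻¹) := by
          rw [pairing_mul, pairing_projDirac (convFun_mem_invFun _ hs_inv), inv_inv]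
      _ = s x * s y := by
          rw [pairing_eq, map_mul, ← apply_eq, ← apply_eq, mul_comm]
  exact ⟨s, hs, AlgHom.ext pairing_eq⟩

lemma isExponentialMaximal_iff {M : Ideal (InvMeasure K)} :
    IsExponentialMaximal K M ↔ ∃ s, IsSpherical K s ∧ sphIdeal K s = M := by
  constructor
  · rintro ⟨-, Φ, hΦ, -, rfl⟩
    obtain ⟨s, hs, rfl⟩ := exists_isSpherical_character_eq Φ hΦ
    exact ⟨s, hs, hs.sphIdeal_eq_ker⟩
  · rintro ⟨s, hs, rfl⟩
    have hsurj : Function.Surjective hs.character :=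
      fun c => ⟨algebraMap ℂ _ c, hs.character.commutes c⟩
    rw [hs.sphIdeal_eq_ker]
    exact ⟨RingHom.ker_isMaximal_of_surjective _ hsurj, hs.character, continuous_pairing s, hsurj,
      rfl⟩

lemma isClosed_ann (V : Submodule ℂ C(G, ℂ)) : IsClosed (ann K V : Set (InvMeasure K)) := by
  have : (ann K V : Set (InvMeasure K)) =
      ⋂ (f ∈ V) (x : G), {μ : InvMeasure K | convFun μ.1 f x = 0} := by
    ext μ
    simp only [Set.mem_iInter]
    exact forall₂_congr fun f _ => DFunLike.ext_iff
  rw [this]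
  exact isClosed_biInter fun f _ => isClosed_iInter fun x =>
    isClosed_singleton.preimage (continuous_convFun_apply f x)

lemma isVariety_inf_ker (μ : InvMeasure K) :
    IsVariety K (invFun K ⊓ LinearMap.ker (convFun μ.1).toLinearMap) where
  le_invFun := inf_le_left
  isClosed := (isClosed_invFun K).inter (isClosed_singleton.preimage (convFun μ.1).continuous)
  translation_mem f hf y := by
    refine ⟨convFun_mem_invFun _ hf.1, ?_⟩
    have hμf : convFun μ.1 f = 0 := hf.2
    change convFun μ.1 (convFun (projDirac K y⁻¹).1 f) = 0
    rw [← convFun_mul, mul_comm, convFun_mul, hμf, map_zero]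

lemma mem_ann_varietyOf_iff (hf : f ∈ invFun K) {μ : InvMeasure K} :
    μ ∈ ann K (varietyOf K f) ↔ convFun μ.1 f = 0 :=
  ⟨fun h => h f (Submodule.mem_sInf.2 fun _ hV => hV.2),
    fun h _ hg => (Submodule.mem_sInf.1 hg _ ⟨isVariety_inf_ker μ, hf, h⟩).2⟩

lemma ann_varietyOf_ne_top (hf : f ∈ invFun K) (hf0 : f ≠ 0) : ann K (varietyOf K f) ≠ ⊤ := by
  rwa [Ideal.ne_top_iff_one, mem_ann_varietyOf_iff hf, convFun_one hf]

lemma sphDiffEq_iff_span_pow_le (hf : f ∈ invFun K) (s : C(G, ℂ)) (n : ℕ) :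
    SphDiffEq K s n f ↔
      Ideal.span (Set.range (sphDiff K s)) ^ (n + 1) ≤ ann K (varietyOf K f) := by
  have sphDiffEq_iff_prod_mem : SphDiffEq K s n f ↔
      ∀ y : Fin (n + 1) → G, ∏ i, sphDiff K s (y i) ∈ ann K (varietyOf K f) :=
    forall_congr' fun y => DFunLike.ext_iff.symm.trans (mem_ann_varietyOf_iff hf).symm
  rw [sphDiffEq_iff_prod_mem, Ideal.span, Submodule.span_pow, Submodule.span_le]
  constructor
  · rintro h _ hμ
    obtain ⟨g, rfl⟩ := Set.mem_pow.1 hμ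
    choose y hy using fun i => (g i).2
    simp_rw [← hy, List.prod_ofFn]
    exact h y
  · intro h y
    refine h (Set.mem_pow.2 ⟨fun i => ⟨sphDiff K s (y i), y i, rfl⟩, ?_⟩)
    rw [List.prod_ofFn]

lemma sphDiffEq_iff_sphIdeal_pow_le (hf : f ∈ invFun K) (s : C(G, ℂ)) (n : ℕ) :
    SphDiffEq K s n f ↔ sphIdeal K s ^ (n + 1) ≤ ann K (varietyOf K f) := by
  rw [sphDiffEq_iff_span_pow_le hf]
  exact ⟨fun h => (topologicalClosure_pow_le _ _).trans
      (Submodule.topologicalClosure_minimal _ h (isClosed_ann _)),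
    (Ideal.pow_right_mono (Submodule.le_topologicalClosure _) _).trans⟩

end Gelfand

end KSpherical

open KSpherical in
theorem mainTheorem10 {G : Type*} [Group G] [TopologicalSpace G] [IsTopologicalGroup G]
    [LocallyCompactSpace G] [T2Space G] [MeasurableSpace G] [BorelSpace G]
    (K : Subgroup G) [CompactSpace K] [IsGelfandPair K]
    (φ : C(G, ℂ)) (hφ : φ ∈ invFun K) (hφ0 : φ ≠ 0) :
    (IsGenMonomial K φ ↔
      ∃! M : Ideal (InvMeasure K), IsExponentialMaximal K M ∧
        ∃ n : ℕ, M ^ (n + 1) ≤ ann K (varietyOf K φ)) ∧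
    (∀ (s : C(G, ℂ)) (n : ℕ), IsSpherical K s → SphDiffEq K s n φ →
      IsExponentialMaximal K (sphIdeal K s) ∧
      sphIdeal K s ^ (n + 1) ≤ ann K (varietyOf K φ) ∧
      ann K (varietyOf K φ) ≤ sphIdeal K s ∧
      ∀ M : Ideal (InvMeasure K), IsExponentialMaximal K M →
        (∃ m : ℕ, M ^ (m + 1) ≤ ann K (varietyOf K φ)) → M = sphIdeal K s) := by
  have hproper := ann_varietyOf_ne_top hφ hφ0
  have huniq {M N : Ideal (InvMeasure K)} (hM : IsExponentialMaximal K M)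
      (hN : IsExponentialMaximal K N) (hMφ : ∃ m : ℕ, M ^ (m + 1) ≤ ann K (varietyOf K φ))
      (hNφ : ∃ n : ℕ, N ^ (n + 1) ≤ ann K (varietyOf K φ)) : M = N :=
    eq_of_pow_le_of_isMaximal hM.1 hN.1 hproper hMφ.choose_spec hNφ.choose_spec
  refine ⟨⟨?_, ?_⟩, fun s n hs h => ?_⟩
  · rintro ⟨-, s, hs, n, h⟩
    have hM := isExponentialMaximal_iff.2 ⟨s, hs, rfl⟩
    have hpow := (sphDiffEq_iff_sphIdeal_pow_le hφ s n).1 h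
    exact ⟨sphIdeal K s, ⟨hM, n, hpow⟩, fun N hN => huniq hN.1 hM hN.2 ⟨n, hpow⟩⟩
  · rintro ⟨M, ⟨hM, n, hpow⟩, -⟩
    obtain ⟨s, hs, rfl⟩ := isExponentialMaximal_iff.1 hM
    exact ⟨hφ, s, hs, n, (sphDiffEq_iff_sphIdeal_pow_le hφ s n).2 hpow⟩
  · have hM := isExponentialMaximal_iff.2 ⟨s, hs, rfl⟩
    have hpow := (sphDiffEq_iff_sphIdeal_pow_le hφ s n).1 h
    exact ⟨hM, hpow, le_of_pow_le_of_isMaximal hM.1 hproper hpow,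
      fun N hN hNφ => huniq hN hM hNφ ⟨n, hpow⟩⟩
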